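/- Let $(M,\rho,\mu)$ be a metric probability space. For $n\ge 1$ and $r\ge 0$, let $G_M(n,r)$ be the random graph on the vertex set $[n]=\{1,\dots,n\}$ obtained by sampling $x_1,\dots,x_n\in M$ independently from $\mu$ and joining distinct $i,j$ exactly when $\rho(x_i,x_j)\le r$. A monotone graph property on $[n]$ is a family $\mathcal F$ of graphs on $[n]$ that is closed under adding edges (it need not be invariant under relabelling the vertices); it is nontrivial if it is neither empty nor the family of all graphs on $[n]$, which forces $n\ge 2$. A sequence of positive radii $(r_n)$ is a threshold for a sequence $(\mathcal F_n)_{n\ge 2}$ of nontrivial monotone properties, $\mathcal F_n$ being a property on $[n]$, if for every sequence of radii $s_n\ge 0$, as $n\to\infty$, $$\mathbb P\bigl(G_M(n,s_n)\in\mathcal F_n\bigr)\to\begin{cases}0&\text{if } s_n/r_n\to 0,\\ 1&\text{if } s_n/r_n\to\infty.\end{cases}$$ The space $(M,\rho,\mu)$ admits thresholds if every sequence $(\mathcal F_n)_{n\ge2}$ of nontrivial monotone properties has a threshold. Theorem. For every integer $d\ge 1$, the flat torus $\mathbb T^d=\mathbb R^d/\mathbb Z^d$, with the metric $\rho(x,y)=\bigl(\sum_{i=1}^d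 \|x_i-y_i\|^2\bigr)^{1/2}$, where $\|t\|$ is the distance from $t$ to the nearest integer, and with normalised Haar measure, admits thresholds. -/

import Mathlib

open Filter Topology MeasureTheory
open scoped ENNReal

/-- The geometric graph of the configuration `x` at radius `r`: distinct `i` and `j` are joined
when `dist (x i) (x j) ≤ r`. -/
def geometricGraph {M : Type*} [MetricSpace M] {n : ℕ} (x : Fin n → M) (r : ℝ) :
    SimpleGraph (Fin n) where
  Adj i j := i ≠ j ∧ dist (x i) (x j) ≤ r
  symm := ⟨fun _ _ h => ⟨h.1.symm, by simpa only [dist_comm] using h.2⟩⟩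
  loopless := ⟨fun _ h => h.1 rfl⟩

/-- A nontrivial monotone property of graphs on `n` labelled vertices: a family of graphs closed
under adding edges that is neither empty nor the family of all graphs. It need not be invariant
under relabelling. -/
structure IsNontrivialMonotone {n : ℕ} (F : Set (SimpleGraph (Fin n))) : Prop where
  monotone : IsUpperSet F
  ne_empty : F ≠ ∅
  ne_univ : F ≠ Set.univ

/-- The probability that the random geometric graph on `n` points sampled independently from `μ`,
at radius `r`, belongs to `F`. -/
noncomputable def geometricProb {M : Type*} [MetricSpace M] [MeasurableSpace M] (μ : Measure M)
    [IsProbabilityMeasure μ] {n : ℕ} (F : Set (SimpleGraph (Fin n))) (r : ℝ) : ℝ≥0∞ :=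
  Measure.pi (fun _ : Fin n => μ) {x | geometricGraph x r ∈ F}

/-- The sequence of (positive) radii `r` is a threshold for the sequence of properties `F`. -/
structure IsThreshold {M : Type*} [MetricSpace M] [MeasurableSpace M] (μ : Measure M)
    [IsProbabilityMeasure μ] (F : ∀ n : ℕ, Set (SimpleGraph (Fin n))) (r : ℕ → ℝ) : Prop where
  pos : ∀ n, 0 < r n
  zero_statement : ∀ s : ℕ → ℝ, (∀ n, 0 ≤ s n) → Tendsto (fun n => s n / r n) atTop (𝓝 0) →
    Tendsto (fun n => geometricProb μ (F n) (s n)) atTop (𝓝 0)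
  one_statement : ∀ s : ℕ → ℝ, (∀ n, 0 ≤ s n) → Tendsto (fun n => s n / r n) atTop atTop →
    Tendsto (fun n => geometricProb μ (F n) (s n)) atTop (𝓝 1)

/-- The metric probability space `(M, dist, μ)` admits thresholds: every sequence of nontrivial
monotone properties has a threshold. Since there is only one graph on `n ≤ 1` vertices, nontrivial
properties exist only for `n ≥ 2`, and this is where the sequence starts. -/
def AdmitsThresholds (M : Type*) [MetricSpace M] [MeasurableSpace M] (μ : Measure M)
    [IsProbabilityMeasure μ] : Prop :=
  ∀ F : ∀ n : ℕ, Set (SimpleGraph (Fin n)), (∀ n, 2 ≤ n → IsNontrivialMonotone (F n)) →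
    ∃ r : ℕ → ℝ, IsThreshold μ F r

/-- The flat torus `ℝ^d / ℤ^d`, as the `ℓ²` product of `d` circles `ℝ / ℤ`. Its distance is
`√(∑ i, ‖x i - y i‖²)`, where `‖·‖` is the distance to the nearest integer. -/
abbrev FlatTorus (d : ℕ) : Type := PiLp 2 (fun _ : Fin d => UnitAddCircle)

instance FlatTorus.compactSpace (d : ℕ) : CompactSpace (FlatTorus d) :=
  (PiLp.homeomorph 2 (fun _ : Fin d => UnitAddCircle)).symm.compactSpace

/-- The normalised Haar measure on the flat torus. -/
noncomputable def torusHaar (d : ℕ) : Measure (FlatTorus d) := Measure.addHaarMeasure ⊤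

instance torusHaar.isProbabilityMeasure (d : ℕ) : IsProbabilityMeasure (torusHaar d) :=
  ⟨Measure.addHaarMeasure_self (K₀ := (⊤ : TopologicalSpace.PositiveCompacts (FlatTorus d)))⟩

/-! Doubling the radius at least doubles the odds of every monotone property. Fold each coordinate
by the tent map centred at a random point `θ`, using the same `θ` for all coordinates and all
vertices. The fold is 2-Lipschitz, preserves Haar measure, and does not change when coordinates are
reflected at `θ`. Let `A` be the set of configurations with the property at radius `r`, of measure
`a`. If some independent choice of reflections, one for each coordinate of each vertex, carries `x`
into `A`, then the folded `x` has the property at radius `2r`, an event of probability `b` whatever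
`θ` is.

Averaging over all reflections halves the variance in the mean over `θ`. On one circle this holds
because `2θ - x` is uniform for each fixed `x`; it tensorises without loss even though `θ` is shared
(`HasAveragingGap.prod`). So the orbit average of the indicator of `A` has mean `a` and second
moment at most `(a + a²)/2` in the mean, and a second-moment bound on its support gives `b ≥ 2a/(1 +
a)`, that is, `b/(1 - b) ≥ 2a/(1 - a)` when `a, b < 1`. With the odds growing at least linearly
along powers of two, the median radius is a threshold. -/

open scoped BigOperators

/-! ### Averages, integrals and variance -/

/-- A bounded measurable real function is integrable for a finite measure. -/
theorem Measurable.integrable_of_abs_le {X : Type*} [MeasurableSpace X] {μ : Measure X}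
    [IsFiniteMeasure μ] {h : X → ℝ} (hm : Measurable h) {C : ℝ} (hC : ∀ x, |h x| ≤ C) :
    Integrable h μ :=
  Integrable.of_bound hm.aestronglyMeasurable C (ae_of_all _ hC)

theorem MeasureTheory.MeasurePreserving.integral_comp_of_measurable {X Y : Type*}
    [MeasurableSpace X] [MeasurableSpace Y] {μ : Measure X} {ν : Measure Y} {f : X → Y}
    (hf : MeasurePreserving f μ ν) {g : Y → ℝ} (hg : Measurable g) :
    ∫ x, g (f x) ∂μ = ∫ y, g y ∂ν := by
  rw [← hf.map_eq, integral_map hf.measurable.aemeasurable hg.aestronglyMeasurable]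

theorem abs_expect_le {E : Type*} [Fintype E] [Nonempty E] {f : E → ℝ} {C : ℝ}
    (hf : ∀ e, |f e| ≤ C) : |𝔼 e, f e| ≤ C :=
  (Finset.abs_expect_le _ _).trans
    (Finset.expect_le Finset.univ_nonempty fun e _ => hf e)

theorem measurable_expect {E X : Type*} [Fintype E] [MeasurableSpace X] {f : E → X → ℝ}
    (hf : ∀ e, Measurable (f e)) : Measurable fun x => 𝔼 e, f e x := by
  simp only [Fintype.expect_eq_sum_div_card]
  exact (Finset.measurable_sum _ fun e _ => hf e).div_const _

theorem integral_expect {E X : Type*} [Fintype E] [MeasurableSpace X] {μ : Measure X}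
    {f : E → X → ℝ} (hf : ∀ e, Integrable (f e) μ) :
    ∫ x, 𝔼 e, f e x ∂μ = 𝔼 e, ∫ x, f e x ∂μ := by
  simp only [Fintype.expect_eq_sum_div_card]
  rw [integral_div, integral_finsetSum _ fun e _ => hf e]

theorem sq_expect_le {E : Type*} [Fintype E] [Nonempty E] (f : E → ℝ) :
    (𝔼 e, f e) ^ 2 ≤ 𝔼 e, f e ^ 2 := by
  simpa using Finset.expect_mul_sq_le_sq_mul_sq Finset.univ f (fun _ => (1 : ℝ))

theorem abs_integral_le_of_abs_le {X : Type*} [MeasurableSpace X] {μ : Measure X}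
    [IsProbabilityMeasure μ] {h : X → ℝ} {C : ℝ} (hC : ∀ x, |h x| ≤ C) : |∫ x, h x ∂μ| ≤ C := by
  simpa using norm_integral_le_of_norm_le_const (μ := μ) (f := h) (ae_of_all _ hC)

theorem abs_sq_le_sq {a C : ℝ} (h : |a| ≤ C) : |a ^ 2| ≤ C ^ 2 := by
  rw [abs_pow]; exact pow_le_pow_left₀ (abs_nonneg a) h 2

/-- Jensen's inequality for the variance: the variance of an average of functions is at most the
average of their variances. -/
theorem integral_sq_expect_sub_le {E Y : Type*} [Fintype E] [Nonempty E] [MeasurableSpace Y]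
    {μ : Measure Y} [IsProbabilityMeasure μ] {p : E → Y → ℝ} (hp : ∀ e, Measurable (p e)) {C : ℝ}
    (hC : ∀ e y, |p e y| ≤ C) :
    ∫ y, (𝔼 e, p e y) ^ 2 ∂μ ≤
      (𝔼 e, ∫ y, p e y ∂μ) ^ 2 + 𝔼 e, (∫ y, p e y ^ 2 ∂μ - (∫ y, p e y ∂μ) ^ 2) := by
  have hip e : Integrable (p e) μ := (hp e).integrable_of_abs_le (hC e)
  have hip2 e : Integrable (fun y => p e y ^ 2) μ :=
    ((hp e).pow_const 2).integrable_of_abs_le fun y => abs_sq_le_sq (hC e y)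
  have hia : Integrable (fun y => 𝔼 e, p e y) μ :=
    (measurable_expect hp).integrable_of_abs_le fun y => abs_expect_le fun e => hC e y
  have hia2 : Integrable (fun y => (𝔼 e, p e y) ^ 2) μ :=
    ((measurable_expect hp).pow_const 2).integrable_of_abs_le fun y =>
      abs_sq_le_sq (abs_expect_le fun e => hC e y)
  have variance {q : Y → ℝ} (hq : Integrable q μ) (hq2 : Integrable (fun y => q y ^ 2) μ) :
      Integrable (fun y => (q y - ∫ z, q z ∂μ) ^ 2) μ ∧
        ∫ y, (q y - ∫ z, q z ∂μ) ^ 2 ∂μ = ∫ y, q y ^ 2 ∂μ - (∫ y, q y ∂μ) ^ 2 := by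
    have hexp : (fun y => (q y - ∫ z, q z ∂μ) ^ 2) =
        fun y => q y ^ 2 - 2 * (∫ z, q z ∂μ) * q y + (∫ z, q z ∂μ) ^ 2 := by
      ext y; ring
    rw [hexp]
    have hlin : Integrable (fun y => q y ^ 2 - 2 * (∫ z, q z ∂μ) * q y) μ :=
      hq2.sub (hq.const_mul _)
    refine ⟨hlin.add (integrable_const _), ?_⟩
    rw [integral_add hlin (integrable_const _),
      integral_sub hq2 (hq.const_mul _), integral_const_mul]
    simp
    ring
  have hmean : ∫ y, 𝔼 e, p e y ∂μ = 𝔼 e, ∫ y, p e y ∂μ := integral_expect hip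
  have key : ∫ y, (𝔼 e, p e y - ∫ z, 𝔼 e, p e z ∂μ) ^ 2 ∂μ ≤
      ∫ y, 𝔼 e, (p e y - ∫ z, p e z ∂μ) ^ 2 ∂μ := by
    refine integral_mono (variance hia hia2).1 ?_ fun y => ?_
    · simp only [Fintype.expect_eq_sum_div_card]
      exact (integrable_finsetSum _ fun e _ => (variance (hip e) (hip2 e)).1).div_const _
    · simp only [hmean, ← Finset.expect_sub_distrib]
      exact sq_expect_le _
  rw [(variance hia hia2).2, integral_expect fun e => (variance (hip e) (hip2 e)).1, hmean] at key
  simp only [(variance (hip _) (hip2 _)).2] at key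
  linarith

/-! ### The averaging gap: tensorisation and expansion of sets -/

/-- A random finite family of measure-preserving maps `R θ e`, whose averaging operators contract
the variance by a factor `1 / 2` in the mean over `θ`. -/
structure HasAveragingGap {Θ X E : Type*} [MeasurableSpace Θ] [MeasurableSpace X] [Fintype E]
    (ν : Measure Θ) (μ : Measure X) (R : Θ → E → X → X) : Prop where
  measurable : ∀ e, Measurable fun p : Θ × X => R p.1 e p.2
  preserving : ∀ θ e, MeasurePreserving (R θ e) μ μ
  gap : ∀ (h : X → ℝ) (C : ℝ), Measurable h → (∀ x, |h x| ≤ C) →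
    ∫ θ, ∫ x, (𝔼 e, h (R θ e x)) ^ 2 ∂μ ∂ν ≤ (∫ x, h x ^ 2 ∂μ + (∫ x, h x ∂μ) ^ 2) / 2

namespace HasAveragingGap

variable {Θ X Y E E' : Type*} [MeasurableSpace Θ] [MeasurableSpace X] [MeasurableSpace Y]
  [Fintype E] [Fintype E'] {ν : Measure Θ} {μ : Measure X} {μ' : Measure Y}
  {R : Θ → E → X → X} {R' : Θ → E' → Y → Y}

theorem measurable_map (hR : HasAveragingGap ν μ R) (θ : Θ) (e : E) : Measurable (R θ e) :=
  (hR.preserving θ e).measurable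

/-- The averaging gap is inherited by products, with the same parameter used in both factors. -/
theorem prod [Nonempty E] [Nonempty E'] [IsProbabilityMeasure ν] [IsProbabilityMeasure μ]
    [IsProbabilityMeasure μ'] (hR : HasAveragingGap ν μ R) (hR' : HasAveragingGap ν μ' R') :
    HasAveragingGap ν (μ'.prod μ)
      (fun θ (e : E' × E) (z : Y × X) => (R' θ e.1 z.1, R θ e.2 z.2)) where
  measurable e := by
    have h1 := (hR'.measurable e.1).comp
      (measurable_fst.prodMk (measurable_fst.comp measurable_snd) : Measurable
        fun p : Θ × (Y × X) => (p.1, p.2.1))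
    have h2 := (hR.measurable e.2).comp
      (measurable_fst.prodMk (measurable_snd.comp measurable_snd) : Measurable
        fun p : Θ × (Y × X) => (p.1, p.2.2))
    exact h1.prodMk h2
  preserving θ e := (hR'.preserving θ e.1).prod (hR.preserving θ e.2)
  gap := by
    intro h C hm hC
    have hmH : Measurable fun x => ∫ y, h (y, x) ∂μ' :=
      (StronglyMeasurable.integral_prod_right (f := fun x y => h (y, x))
        (hm.comp measurable_swap).stronglyMeasurable).measurable
    have hCH x : |∫ y, h (y, x) ∂μ'| ≤ C := abs_integral_le_of_abs_le fun y => hC _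
    set H : X → ℝ := fun x => ∫ y, h (y, x) ∂μ'
    -- The average over the first factor alone; since `R'` preserves measure, its mean on each fibre
    -- is still `H x`.
    let p : Θ → Y → X → ℝ := fun θ y x => 𝔼 e, h (R' θ e y, x)
    have hmp : Measurable fun q : (Θ × X) × Y => p q.1.1 q.2 q.1.2 := by
      refine measurable_expect fun e => hm.comp (Measurable.prodMk ?_ ?_)
      · exact (hR'.measurable e).comp ((measurable_fst.comp measurable_fst).prodMk measurable_snd)
      · exact measurable_snd.comp measurable_fst
    have hCp θ y x : |p θ y x| ≤ C := abs_expect_le fun e => hC _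
    have hpH θ x : ∫ y, p θ y x ∂μ' = H x := by
      rw [integral_expect]
      · have he e : ∫ y, h (R' θ e y, x) ∂μ' = H x :=
          (hR'.preserving θ e).integral_comp_of_measurable (g := fun y => h (y, x))
            (hm.comp measurable_prodMk_right)
        simp [he]
      · exact fun e => (hm.comp ((hR'.measurable_map θ e).prodMk
          measurable_const)).integrable_of_abs_le fun y => hC _
    let V : Θ × X → ℝ := fun q => ∫ y, p q.1 y q.2 ^ 2 ∂μ'
    have hmV : Measurable V :=
      ((hmp.pow_const 2).stronglyMeasurable.integral_prod_right).measurable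
    have hCV q : |V q| ≤ C ^ 2 := abs_integral_le_of_abs_le fun y => abs_sq_le_sq (hCp _ _ _)
    let W : Θ → ℝ := fun θ => ∫ x, (𝔼 e, H (R θ e x)) ^ 2 ∂μ
    have hmavg : Measurable fun q : Θ × X => (𝔼 e, H (R q.1 e q.2)) ^ 2 :=
      (measurable_expect fun e => hmH.comp (hR.measurable e)).pow_const 2
    have hCavg (q : Θ × X) : |(𝔼 e, H (R q.1 e q.2)) ^ 2| ≤ C ^ 2 :=
      abs_sq_le_sq (abs_expect_le fun e => hCH _)
    have hmH2 : Measurable fun x => H x ^ 2 := hmH.pow_const 2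
    have hCH2 x : |H x ^ 2| ≤ C ^ 2 := abs_sq_le_sq (hCH x)
    have hiH2 : Integrable (fun x => H x ^ 2) μ := hmH2.integrable_of_abs_le hCH2
    have hmh2 : Measurable fun z => h z ^ 2 := hm.pow_const 2
    have hCh2 z : |h z ^ 2| ≤ C ^ 2 := abs_sq_le_sq (hC z)
    have hmVθ θ : Measurable fun x => V (θ, x) := hmV.comp measurable_prodMk_left
    have hiVθ θ : Integrable (fun x => V (θ, x)) μ :=
      (hmVθ θ).integrable_of_abs_le fun x => hCV _
    have hmVθH θ : Measurable fun x => V (θ, x) - H x ^ 2 := (hmVθ θ).sub hmH2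
    have hiVθH θ : Integrable (fun x => V (θ, x) - H x ^ 2) μ := (hiVθ θ).sub hiH2
    -- for each parameter, split the variance of the average along the second factor
    have hsplit θ : ∫ z, (𝔼 e : E' × E, h (R' θ e.1 z.1, R θ e.2 z.2)) ^ 2 ∂(μ'.prod μ) ≤
        W θ + (∫ x, V (θ, x) ∂μ - ∫ x, H x ^ 2 ∂μ) := by
      have havg z : 𝔼 e : E' × E, h (R' θ e.1 (Prod.fst z), R θ e.2 (Prod.snd z)) =
          𝔼 e, p θ z.1 (R θ e z.2) := by
        rw [← Finset.univ_product_univ, Finset.expect_product, Finset.expect_comm]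
      simp only [havg]
      have hmpe e : Measurable fun z : Y × X => p θ z.1 (R θ e z.2) :=
        hmp.comp ((measurable_const.prodMk
          ((hR.measurable_map θ e).comp measurable_snd)).prodMk measurable_fst)
      have hmsq : Measurable fun z : Y × X => (𝔼 e, p θ z.1 (R θ e z.2)) ^ 2 :=
        (measurable_expect hmpe).pow_const 2
      have hCsq (z : Y × X) : |(𝔼 e, p θ z.1 (R θ e z.2)) ^ 2| ≤ C ^ 2 :=
        abs_sq_le_sq (abs_expect_le fun e => hCp _ _ _)
      rw [integral_prod_symm _ (hmsq.integrable_of_abs_le hCsq)]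
      have hint e : Integrable (fun x => V (θ, R θ e x) - H (R θ e x) ^ 2) μ :=
        (hR.preserving θ e).integrable_comp_of_integrable (hiVθH θ)
      have hintE : Integrable (fun x => 𝔼 e, (V (θ, R θ e x) - H (R θ e x) ^ 2)) μ := by
        simp only [Fintype.expect_eq_sum_div_card]
        exact (integrable_finsetSum _ fun e _ => hint e).div_const _
      have hiavg : Integrable (fun x => (𝔼 e, H (R θ e x)) ^ 2) μ :=
        (hmavg.comp measurable_prodMk_left).integrable_of_abs_le fun x => hCavg (θ, x)
      -- Jensen on each fibre bounds the variance in `y` of the average over `e` by the average of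
      -- the fibre variances `V - H ^ 2`; invariance of `μ` under `R θ e` then removes `e`.
      calc ∫ x, ∫ y, (𝔼 e, p θ y (R θ e x)) ^ 2 ∂μ' ∂μ
          ≤ ∫ x, ((𝔼 e, H (R θ e x)) ^ 2 + 𝔼 e, (V (θ, R θ e x) - H (R θ e x) ^ 2)) ∂μ := by
            refine integral_mono ?_ (hiavg.add hintE) fun x => ?_
            · exact (StronglyMeasurable.integral_prod_right
                (f := fun x y => (𝔼 e, p θ y (R θ e x)) ^ 2)
                (hmsq.comp measurable_swap).stronglyMeasurable).measurable.integrable_of_abs_le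
                  (C := C ^ 2) fun x => abs_integral_le_of_abs_le fun y => hCsq (y, x)
            · have := integral_sq_expect_sub_le (μ := μ') (p := fun e y => p θ y (R θ e x))
                (fun e => (hmpe e).comp measurable_prodMk_right) (fun e y => hCp _ _ _)
              simpa only [hpH] using this
        _ = W θ + 𝔼 e, ∫ x, (V (θ, R θ e x) - H (R θ e x) ^ 2) ∂μ := by
            rw [integral_add hiavg hintE, integral_expect hint]
        _ = W θ + (∫ x, V (θ, x) ∂μ - ∫ x, H x ^ 2 ∂μ) := by
            have he e : ∫ x, (V (θ, R θ e x) - H (R θ e x) ^ 2) ∂μ =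
                ∫ x, V (θ, x) ∂μ - ∫ x, H x ^ 2 ∂μ := by
              rw [← integral_sub (hiVθ θ) hiH2]
              exact (hR.preserving θ e).integral_comp_of_measurable (hmVθH θ)
            simp [he]
    have hiW : Integrable W ν :=
      hmavg.stronglyMeasurable.integral_prod_right.measurable.integrable_of_abs_le
        (C := C ^ 2) fun θ => abs_integral_le_of_abs_le fun x => hCavg (θ, x)
    have hiV : Integrable (fun θ => ∫ x, V (θ, x) ∂μ) ν :=
      hmV.stronglyMeasurable.integral_prod_right.measurable.integrable_of_abs_le
        (C := C ^ 2) fun θ => abs_integral_le_of_abs_le fun x => hCV (θ, x)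
    have hW : ∫ θ, W θ ∂ν ≤ (∫ x, H x ^ 2 ∂μ + (∫ x, H x ∂μ) ^ 2) / 2 := hR.gap H C hmH hCH
    have hih2 : Integrable (fun z => h z ^ 2) (μ'.prod μ) := hmh2.integrable_of_abs_le hCh2
    have hV : ∫ θ, ∫ x, V (θ, x) ∂μ ∂ν ≤
        (∫ z, h z ^ 2 ∂(μ'.prod μ) + ∫ x, H x ^ 2 ∂μ) / 2 := by
      rw [integral_integral_swap (f := fun θ x => V (θ, x)) (hmV.integrable_of_abs_le hCV),
        integral_prod_symm _ hih2]
      have hi2 : Integrable (fun x => ∫ y, h (y, x) ^ 2 ∂μ') μ := hih2.integral_prod_right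
      rw [← integral_add hi2 hiH2, ← integral_div]
      refine integral_mono ?_ ((hi2.add hiH2).div_const 2) fun x => ?_
      · exact (hmV.integrable_of_abs_le (μ := ν.prod μ) hCV).integral_prod_right
      · exact hR'.gap (fun y => h (y, x)) C (hm.comp measurable_prodMk_right) fun y => hC _
    have hmean : ∫ z, h z ∂(μ'.prod μ) = ∫ x, H x ∂μ :=
      integral_prod_symm _ (hm.integrable_of_abs_le hC)
    have hmain : ∫ θ, ∫ z, (𝔼 e : E' × E, h (R' θ e.1 z.1, R θ e.2 z.2)) ^ 2 ∂(μ'.prod μ) ∂ν ≤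
        ∫ θ, (W θ + (∫ x, V (θ, x) ∂μ - ∫ x, H x ^ 2 ∂μ)) ∂ν :=
      -- Nonnegativity of the left integrand makes its integrability in `θ` unnecessary.
      integral_mono_of_nonneg (ae_of_all _ fun θ => integral_nonneg fun z => sq_nonneg _)
        (hiW.add (hiV.sub (integrable_const _))) (ae_of_all _ hsplit)
    have hiVH : Integrable (fun θ => ∫ x, V (θ, x) ∂μ - ∫ x, H x ^ 2 ∂μ) ν :=
      hiV.sub (integrable_const _)
    rw [integral_add hiW hiVH, integral_sub hiV (integrable_const _)] at hmain
    simp only [integral_const, probReal_univ, one_smul] at hmain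
    rw [hmean]
    -- The gaps for `H` and for the fibres add up to `(∫ h² + 2 ∫ H² + (∫ H)²) / 2`; subtracting `∫
    -- H²` leaves exactly the claim, so the factor `1 / 2` does not degrade.
    linarith

/-- The averaging gap is transported by a measure-preserving measurable equivalence, together with
a reindexing of the family. -/
theorem of_equiv [IsProbabilityMeasure μ] (hR : HasAveragingGap ν μ R) (f : Y ≃ᵐ X)
    (hf : MeasurePreserving f μ' μ) (g : E' ≃ E)
    (hfg : ∀ θ e y, f (R' θ e y) = R θ (g e) (f y)) : HasAveragingGap ν μ' R' := by
  have hR' : ∀ θ e, R' θ e = fun y => f.symm (R θ (g e) (f y)) := fun θ e => by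
    ext y; rw [← hfg, f.symm_apply_apply]
  refine ⟨fun e => ?_, fun θ e => ?_, fun h C hm hC => ?_⟩
  · simp only [hR']
    exact f.symm.measurable.comp ((hR.measurable (g e)).comp
      (measurable_fst.prodMk (f.measurable.comp measurable_snd)))
  · rw [hR']
    exact (hf.symm f).comp ((hR.preserving θ (g e)).comp hf)
  · have h1 := hR.gap (fun x => h (f.symm x)) C (hm.comp f.symm.measurable) fun x => hC _
    rw [← hf.integral_comp' (g := fun x => h (f.symm x)),
      ← hf.integral_comp' (g := fun x => h (f.symm x) ^ 2)] at h1
    simp only [f.symm_apply_apply] at h1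
    refine le_trans (le_of_eq ?_) h1
    refine integral_congr_ae (ae_of_all _ fun θ => ?_)
    simp only
    rw [← hf.integral_comp' (g := fun x => (𝔼 e, h (f.symm (R θ e x))) ^ 2)]
    refine integral_congr_ae (ae_of_all _ fun y => ?_)
    simp only [hR']
    rw [Fintype.expect_equiv g _ (fun e => h (f.symm (R θ e (f y)))) fun e => rfl]

/-- The averaging gap is inherited by finite powers. -/
theorem pi [Nonempty E] [IsProbabilityMeasure ν] [IsProbabilityMeasure μ]
    (hR : HasAveragingGap ν μ R) (n : ℕ) :
    HasAveragingGap ν (Measure.pi fun _ : Fin n => μ)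
      (fun θ (e : Fin n → E) x i => R θ (e i) (x i)) := by
  induction n with
  | zero =>
    refine ⟨fun e => measurable_pi_lambda _ fun i => i.elim0, fun θ e => ?_, fun h C hm hC => ?_⟩
    · convert MeasurePreserving.id _
    -- On a one-point space the gap is an equality.
    · have hx (x : Fin 0 → X) : h x = h default := congrArg h (Subsingleton.elim _ _)
      simp only [hx]
      simp
  | succ n ih =>
    exact (ih.prod hR).of_equiv (MeasurableEquiv.piFinSuccAbove (fun _ => X) 0)
      (measurePreserving_piFinSuccAbove (fun _ => μ) 0) (Fin.insertNthEquiv (fun _ => E) 0).symm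
      fun θ e x => rfl

/-- A family of sets, all of measure `b`, that contain the orbits meeting `A` satisfies
`2 a ≤ b (1 + a)`, where `a` is the measure of `A`. -/
theorem two_mul_measureReal_le [Nonempty E] [IsProbabilityMeasure ν] [IsProbabilityMeasure μ]
    (hR : HasAveragingGap ν μ R) {A : Set X} (hA : MeasurableSet A) {S : Θ → Set X}
    (hS : ∀ θ, MeasurableSet (S θ)) (hRS : ∀ θ e x, R θ e x ∈ A → x ∈ S θ) {b : ℝ}
    (hb : ∀ θ, μ.real (S θ) = b) : 2 * μ.real A ≤ b * (1 + μ.real A) := by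
  set a := μ.real A
  have ha0 : 0 ≤ a := measureReal_nonneg
  let h : X → ℝ := A.indicator 1
  have hm : Measurable h := measurable_one.indicator hA
  have hC x : |h x| ≤ 1 := by
    by_cases hx : x ∈ A <;> simp [h, hx]
  have hint : ∫ x, h x ∂μ = a := integral_indicator_one hA
  have hint2 : ∫ x, h x ^ 2 ∂μ = a := by
    rw [← hint]
    refine integral_congr_ae (ae_of_all _ fun x => ?_)
    by_cases hx : x ∈ A <;> simp [h, hx]
  have hgap := hR.gap h 1 hm hC
  rw [hint, hint2] at hgap
  -- The orbit average of the indicator of `A`: it has mean `a` and vanishes off `S θ`.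
  let q : Θ → X → ℝ := fun θ x => 𝔼 e, h (R θ e x)
  have hqm : Measurable fun p : Θ × X => q p.1 p.2 :=
    measurable_expect fun e => hm.comp (hR.measurable e)
  have hqC θ x : |q θ x| ≤ 1 := abs_expect_le fun e => hC _
  have hqmθ θ : Measurable (q θ) := hqm.comp measurable_prodMk_left
  have hqi θ : Integrable (q θ) μ := (hqmθ θ).integrable_of_abs_le (hqC θ)
  have hq2i θ : Integrable (fun x => q θ x ^ 2) μ :=
    ((hqmθ θ).pow_const 2).integrable_of_abs_le fun x => abs_sq_le_sq (hqC θ x)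
  have hqint θ : ∫ x, q θ x ∂μ = a := by
    have hi e : Integrable (fun x => h (R θ e x)) μ :=
      (hm.comp (hR.measurable_map θ e)).integrable_of_abs_le fun x => hC _
    have he e : ∫ x, h (R θ e x) ∂μ = a :=
      ((hR.preserving θ e).integral_comp_of_measurable hm).trans hint
    rw [integral_expect hi]
    simp [he]
  -- This `t` maximises `2ta - t²(a + a²)/2`, with maximum `2a/(1 + a)`.
  let t : ℝ := 2 / (1 + a)
  -- Linearised Cauchy–Schwarz, which can be averaged over `θ`: `2tq - t²q² ≤ 1` everywhere, and the
  -- left side is `0` off `S θ`.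
  have hθ θ : 2 * t * a - t ^ 2 * ∫ x, q θ x ^ 2 ∂μ ≤ b := by
    have hSint : ∫ x, (S θ).indicator (1 : X → ℝ) x ∂μ = b :=
      (integral_indicator_one (hS θ)).trans (hb θ)
    have hSi : Integrable ((S θ).indicator (1 : X → ℝ)) μ :=
      (integrable_const (1 : ℝ)).indicator (hS θ)
    rw [← hSint, ← hqint θ, ← integral_const_mul, ← integral_const_mul,
      ← integral_sub ((hqi θ).const_mul _) ((hq2i θ).const_mul _)]
    refine integral_mono (((hqi θ).const_mul _).sub ((hq2i θ).const_mul _)) hSi fun x => ?_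
    change 2 * t * q θ x - t ^ 2 * q θ x ^ 2 ≤ _
    by_cases hx : x ∈ S θ
    · rw [Set.indicator_of_mem hx, Pi.one_apply]
      linarith [sq_nonneg (1 - t * q θ x)]
    · have hq0 : q θ x = 0 :=
        Finset.expect_eq_zero fun e _ => Set.indicator_of_notMem (fun he => hx (hRS θ e x he)) _
      rw [Set.indicator_of_notMem hx, hq0]
      simp
  have hiq : Integrable (fun θ => ∫ x, q θ x ^ 2 ∂μ) ν :=
    (hqm.pow_const 2).stronglyMeasurable.integral_prod_right.measurable.integrable_of_abs_le
      (C := 1 ^ 2) fun θ => abs_integral_le_of_abs_le fun x => abs_sq_le_sq (hqC θ x)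
  have hmain : ∫ θ, (2 * t * a - t ^ 2 * ∫ x, q θ x ^ 2 ∂μ) ∂ν ≤ ∫ _, b ∂ν :=
    integral_mono ((integrable_const _).sub (hiq.const_mul _)) (integrable_const b) hθ
  rw [integral_sub (integrable_const _) (hiq.const_mul _)] at hmain
  simp only [integral_const_mul, integral_const, probReal_univ, one_smul] at hmain
  have hle : 2 * t * a - t ^ 2 * ((a + a ^ 2) / 2) ≤ b :=
    (sub_le_sub_left (mul_le_mul_of_nonneg_left hgap (sq_nonneg t)) _).trans hmain
  have hval : 2 * t * a - t ^ 2 * ((a + a ^ 2) / 2) = 2 * a / (1 + a) := by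
    simp only [t]
    field_simp
    ring
  rwa [hval, div_le_iff₀ (by positivity)] at hle

end HasAveragingGap

/-! ### Tent map and reflections on the circle -/

namespace UnitAddCircle

/-- The tent map `t ↦ 2‖t‖` on the circle. -/
noncomputable def tent (x : UnitAddCircle) : UnitAddCircle := ((2 * ‖x‖ : ℝ) : UnitAddCircle)

theorem tent_neg (x : UnitAddCircle) : tent (-x) = tent x := by
  rw [tent, tent, norm_neg]

theorem lipschitzWith_tent : LipschitzWith 2 tent := by
  refine LipschitzWith.of_dist_le_mul fun x y => ?_
  rw [dist_eq_norm, dist_eq_norm, tent, tent, ← AddCircle.coe_sub, ← mul_sub]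
  calc ‖((2 * (‖x‖ - ‖y‖) : ℝ) : UnitAddCircle)‖ ≤ |2 * (‖x‖ - ‖y‖)| :=
        QuotientAddGroup.norm_mk_le_norm
    _ = 2 * |‖x‖ - ‖y‖| := by rw [abs_mul, abs_two]
    _ ≤ 2 * ‖x - y‖ := by gcongr; exact abs_norm_sub_norm_le x y

theorem norm_coe_of_mem_Icc {t : ℝ} (ht : t ∈ Set.Icc (0 : ℝ) (1 / 2)) :
    ‖(t : UnitAddCircle)‖ = t := by
  rw [(AddCircle.norm_coe_eq_abs_iff 1 one_ne_zero).2] <;> rw [abs_of_nonneg ht.1]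
  simpa using ht.2

theorem norm_mem_Icc (x : UnitAddCircle) : ‖x‖ ∈ Set.Icc (0 : ℝ) (1 / 2) :=
  ⟨norm_nonneg x, by simpa using AddCircle.norm_le_half_period 1 one_ne_zero (x := x)⟩

theorem coe_norm_eq_or (x : UnitAddCircle) :
    ((‖x‖ : ℝ) : UnitAddCircle) = x ∨ ((‖x‖ : ℝ) : UnitAddCircle) = -x := by
  obtain ⟨t, ht, rfl⟩ : ∃ t : ℝ, |t| ≤ 1 / 2 ∧ (t : UnitAddCircle) = x := by
    induction x using QuotientAddGroup.induction_on with
    | H z =>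
      refine ⟨z - round z, abs_sub_round z, ?_⟩
      have : ((round z : ℝ) : UnitAddCircle) = 0 := by
        rw [AddCircle.coe_eq_zero_iff]
        exact ⟨round z, by simp⟩
      exact (AddCircle.coe_sub 1 _ _).trans (by rw [this, sub_zero])
  rw [(AddCircle.norm_coe_eq_abs_iff 1 one_ne_zero).2 (by simpa using ht)]
  rcases abs_choice t with h | h <;> rw [h]
  · exact Or.inl rfl
  · exact Or.inr (AddCircle.coe_neg 1)

theorem two_zsmul_half : (2 : ℤ) • ((1 / 2 : ℝ) : UnitAddCircle) = 0 := by
  rw [← AddCircle.coe_zsmul, AddCircle.coe_eq_zero_iff]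
  exact ⟨1, by simp⟩

/-- The half circle `[0, 1/2]`. -/
def upperHalf : Set UnitAddCircle := {x | ((‖x‖ : ℝ) : UnitAddCircle) = x}

theorem isClosed_upperHalf : IsClosed upperHalf :=
  isClosed_eq ((AddCircle.continuous_mk' 1).comp continuous_norm) continuous_id

/-- Unlike negation, `x ↦ 1/2 - x` maps the closed half circle to itself, endpoints included, so no
null set has to be discarded below. -/
theorem half_sub_mem_upperHalf {x : UnitAddCircle} (hx : x ∈ upperHalf) :
    ((1 / 2 : ℝ) : UnitAddCircle) - x ∈ upperHalf := by
  have hn := norm_mem_Icc x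
  change _ = x at hx
  rw [← hx, ← AddCircle.coe_sub, upperHalf, Set.mem_ofPred_eq,
    norm_coe_of_mem_Icc ⟨by linarith [hn.2], by linarith [hn.1]⟩]

theorem half_sub_mem_upperHalf_iff {x : UnitAddCircle} :
    ((1 / 2 : ℝ) : UnitAddCircle) - x ∈ upperHalf ↔ x ∈ upperHalf :=
  ⟨fun h => by simpa using half_sub_mem_upperHalf h, half_sub_mem_upperHalf⟩

theorem tent_of_mem_upperHalf {x : UnitAddCircle} (hx : x ∈ upperHalf) :
    tent x = (2 : ℤ) • x := by
  change _ = x at hx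
  conv_rhs => rw [← hx]
  rw [tent, ← AddCircle.coe_zsmul, zsmul_eq_mul, Int.cast_ofNat]

theorem tent_of_notMem_upperHalf {x : UnitAddCircle} (hx : x ∉ upperHalf) :
    tent x = (2 : ℤ) • (((1 / 2 : ℝ) : UnitAddCircle) - x) := by
  have hx' := (coe_norm_eq_or x).resolve_left hx
  rw [smul_sub, two_zsmul_half, zero_sub, ← smul_neg, ← hx', tent, ← AddCircle.coe_zsmul,
    zsmul_eq_mul, Int.cast_ofNat]

/-- The tent map is doubling on `upperHalf` and doubling after `x ↦ 1/2 - x` on the complement. This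
reflection preserves both pieces, so a preimage under the tent map has, piece by piece, the measure
of the preimage under doubling, which preserves Haar measure. -/
theorem measurePreserving_tent :
    MeasurePreserving tent (AddCircle.haarAddCircle (T := 1)) AddCircle.haarAddCircle := by
  refine ⟨lipschitzWith_tent.continuous.measurable, Measure.ext fun B hB => ?_⟩
  set μ : Measure UnitAddCircle := AddCircle.haarAddCircle
  have hD : MeasurePreserving (fun x : UnitAddCircle => (2 : ℤ) • x) μ μ :=
    Measure.measurePreserving_zsmul μ two_ne_zero
  have hρ : MeasurePreserving (fun x : UnitAddCircle => ((1 / 2 : ℝ) : UnitAddCircle) - x) μ μ :=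
    μ.measurePreserving_sub_left _
  have hP : MeasurableSet upperHalf := isClosed_upperHalf.measurableSet
  have h1 : tent ⁻¹' B ∩ upperHalf = (fun x : UnitAddCircle => (2 : ℤ) • x) ⁻¹' B ∩ upperHalf := by
    ext x
    refine and_congr_left fun hx => ?_
    rw [Set.mem_preimage, tent_of_mem_upperHalf hx, Set.mem_preimage]
  have h2 : tent ⁻¹' B \ upperHalf = (fun x : UnitAddCircle => ((1 / 2 : ℝ) : UnitAddCircle) - x) ⁻¹'
      ((fun x : UnitAddCircle => (2 : ℤ) • x) ⁻¹' B \ upperHalf) := by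
    ext x
    rw [Set.mem_preimage, Set.mem_sdiff, Set.mem_sdiff, half_sub_mem_upperHalf_iff]
    refine and_congr_left fun hx => ?_
    rw [Set.mem_preimage, tent_of_notMem_upperHalf hx, Set.mem_preimage]
  rw [Measure.map_apply lipschitzWith_tent.continuous.measurable hB,
    ← measure_inter_add_sdiff (tent ⁻¹' B) hP, h1, h2,
    hρ.measure_preimage ((hD.measurable hB).diff hP).nullMeasurableSet,
    measure_inter_add_sdiff _ hP, hD.measure_preimage hB.nullMeasurableSet]

/-- The identity (`e = false`) and the reflection at `θ` (`e = true`). -/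
def reflection (θ : UnitAddCircle) (e : Bool) (x : UnitAddCircle) : UnitAddCircle :=
  if e then (2 : ℤ) • θ - x else x

theorem tent_reflection_sub (θ : UnitAddCircle) (e : Bool) (x : UnitAddCircle) :
    tent (reflection θ e x - θ) = tent (x - θ) := by
  cases e
  · rfl
  · rw [reflection, if_pos rfl, ← tent_neg]
    congr 1
    rw [two_zsmul]
    abel

/-- Only the correlation of `h x` with `h (2θ - x)` depends on `θ`. For fixed `x` the point `2θ - x`
is Haar distributed, so this correlation averages to `(∫ h)²` and the gap holds with equality. -/
theorem hasAveragingGap_reflection :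
    HasAveragingGap (AddCircle.haarAddCircle (T := 1)) AddCircle.haarAddCircle reflection := by
  set μ : Measure UnitAddCircle := AddCircle.haarAddCircle
  have hcont : Continuous fun p : UnitAddCircle × UnitAddCircle => (2 : ℤ) • p.1 - p.2 := by
    fun_prop
  refine ⟨fun e => ?_, fun θ e => ?_, fun h C hm hC => ?_⟩
  · cases e
    · exact measurable_snd
    · exact hcont.measurable
  · cases e
    · exact MeasurePreserving.id μ
    · exact μ.measurePreserving_sub_left _
  · have hi : Integrable h μ := hm.integrable_of_abs_le hC
    have hm2 : Measurable fun x => h x ^ 2 := hm.pow_const 2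
    have hi2 : Integrable (fun x => h x ^ 2) μ :=
      hm2.integrable_of_abs_le fun x => abs_sq_le_sq (hC x)
    have hmc : Measurable fun p : UnitAddCircle × UnitAddCircle =>
        h p.2 * h ((2 : ℤ) • p.1 - p.2) :=
      (hm.comp measurable_snd).mul (hm.comp hcont.measurable)
    have hCc (p : UnitAddCircle × UnitAddCircle) : |h p.2 * h ((2 : ℤ) • p.1 - p.2)| ≤ C * C := by
      rw [abs_mul]
      exact mul_le_mul (hC _) (hC _) (abs_nonneg _) ((abs_nonneg _).trans (hC 0))
    have hic : Integrable (fun p : UnitAddCircle × UnitAddCircle =>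
        h p.2 * h ((2 : ℤ) • p.1 - p.2)) (μ.prod μ) := hmc.integrable_of_abs_le hCc
    have hcross : ∫ θ, ∫ x, h x * h ((2 : ℤ) • θ - x) ∂μ ∂μ = (∫ x, h x ∂μ) ^ 2 := by
      rw [integral_integral_swap (f := fun θ x => h x * h ((2 : ℤ) • θ - x)) hic]
      have hx x : ∫ θ, h x * h ((2 : ℤ) • θ - x) ∂μ = h x * ∫ θ, h θ ∂μ := by
        have hp : MeasurePreserving (fun θ : UnitAddCircle => (2 : ℤ) • θ - x) μ μ :=
          (measurePreserving_sub_right μ x).comp (Measure.measurePreserving_zsmul μ two_ne_zero)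
        rw [integral_const_mul]
        rw [hp.integral_comp_of_measurable hm]
      simp only [hx]
      rw [integral_mul_const, sq]
    have hθ θ : ∫ x, (𝔼 e, h (reflection θ e x)) ^ 2 ∂μ =
        (∫ x, h x ^ 2 ∂μ + ∫ x, h x * h ((2 : ℤ) • θ - x) ∂μ) / 2 := by
      have hp : MeasurePreserving (fun x : UnitAddCircle => (2 : ℤ) • θ - x) μ μ :=
        μ.measurePreserving_sub_left _
      have hr : ∫ x, h ((2 : ℤ) • θ - x) ^ 2 ∂μ = ∫ x, h x ^ 2 ∂μ :=
        hp.integral_comp_of_measurable hm2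
      have hir : Integrable (fun x => h ((2 : ℤ) • θ - x) ^ 2) μ :=
        (hm2.comp hp.measurable).integrable_of_abs_le fun x => abs_sq_le_sq (hC _)
      have hicθ : Integrable (fun x => h x * h ((2 : ℤ) • θ - x)) μ :=
        (hmc.comp measurable_prodMk_left).integrable_of_abs_le fun x => hCc (θ, x)
      have hexp x : (𝔼 e, h (reflection θ e x)) ^ 2 =
          h x ^ 2 / 4 + h ((2 : ℤ) • θ - x) ^ 2 / 4 + h x * h ((2 : ℤ) • θ - x) / 2 := by
        simp only [Fintype.expect_eq_sum_div_card, Fintype.sum_bool, Fintype.card_bool, reflection,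
          if_true, Bool.false_eq_true, if_false]
        ring
      have hsum : Integrable (fun x => h x ^ 2 / 4 + h ((2 : ℤ) • θ - x) ^ 2 / 4) μ :=
        (hi2.div_const 4).add (hir.div_const 4)
      simp only [hexp]
      rw [integral_add hsum (hicθ.div_const 2), integral_add (hi2.div_const 4) (hir.div_const 4),
        integral_div, integral_div, integral_div, hr]
      ring
    simp only [hθ]
    rw [integral_div, integral_add (integrable_const _) hic.integral_prod_left, hcross]
    simp

end UnitAddCircle

/-! ### Folding and reflecting the flat torus -/

namespace FlatTorus

/-- Coordinatewise identification of the flat torus with a power of the circle. -/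
def coordEquiv (d : ℕ) : FlatTorus d ≃ᵐ (Fin d → UnitAddCircle) :=
  (MeasurableEquiv.toLp 2 (Fin d → UnitAddCircle)).symm

/-- Both measures are Haar probability measures, hence equal by uniqueness. -/
theorem measurePreserving_coordEquiv (d : ℕ) :
    MeasurePreserving (coordEquiv d) (torusHaar d)
      (Measure.pi fun _ => AddCircle.haarAddCircle) := by
  refine ⟨(coordEquiv d).measurable, ?_⟩
  have hcont : Continuous (coordEquiv d) := PiLp.continuous_ofLp 2 _
  have : IsProbabilityMeasure ((torusHaar d).map (coordEquiv d)) :=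
    Measure.isProbabilityMeasure_map (coordEquiv d).measurable.aemeasurable
  have : (torusHaar d).IsAddHaarMeasure := by unfold torusHaar; infer_instance
  have : ((torusHaar d).map (coordEquiv d)).IsAddHaarMeasure :=
    ((WithLp.linearEquiv 2 ℤ (Fin d → UnitAddCircle)).toAddEquiv.isAddHaarMeasure_map (torusHaar d)
      hcont (PiLp.continuous_toLp 2 _))
  exact Measure.isAddHaarMeasure_eq_of_isProbabilityMeasure _ _

/-- Coordinatewise tent map centred at `θ`. -/
noncomputable def fold (d : ℕ) (θ : UnitAddCircle) (x : FlatTorus d) : FlatTorus d :=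
  WithLp.toLp 2 fun i => UnitAddCircle.tent (x i - θ)

/-- Reflection at `θ` of the coordinates selected by `e`. -/
noncomputable def reflection (d : ℕ) (θ : UnitAddCircle) (e : Fin d → Bool) (x : FlatTorus d) :
    FlatTorus d :=
  WithLp.toLp 2 fun i => UnitAddCircle.reflection θ (e i) (x i)

theorem fold_reflection (d : ℕ) (θ : UnitAddCircle) (e : Fin d → Bool) (x : FlatTorus d) :
    fold d θ (reflection d θ e x) = fold d θ x := by
  simp only [fold, reflection, UnitAddCircle.tent_reflection_sub]

theorem lipschitzWith_fold (d : ℕ) (θ : UnitAddCircle) : LipschitzWith 2 (fold d θ) := by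
  refine LipschitzWith.of_dist_le_mul fun x y => ?_
  rw [PiLp.dist_eq_of_L2, PiLp.dist_eq_of_L2]
  refine Real.sqrt_le_iff.2 ⟨by positivity, ?_⟩
  rw [mul_pow, Real.sq_sqrt (Finset.sum_nonneg fun i _ => sq_nonneg _), Finset.mul_sum]
  refine Finset.sum_le_sum fun i _ => ?_
  rw [← mul_pow]
  refine pow_le_pow_left₀ dist_nonneg ?_ 2
  refine (UnitAddCircle.lipschitzWith_tent.dist_le_mul (x i - θ) (y i - θ)).trans_eq ?_
  rw [dist_sub_right]

theorem measurePreserving_fold (d : ℕ) (θ : UnitAddCircle) :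
    MeasurePreserving (fold d θ) (torusHaar d) (torusHaar d) := by
  have h1 : MeasurePreserving (fun x : UnitAddCircle => UnitAddCircle.tent (x - θ))
      AddCircle.haarAddCircle AddCircle.haarAddCircle :=
    UnitAddCircle.measurePreserving_tent.comp
      (measurePreserving_sub_right AddCircle.haarAddCircle θ)
  have h2 := measurePreserving_coordEquiv d
  exact (h2.symm _).comp ((measurePreserving_pi _ _ fun _ : Fin d => h1).comp h2)

theorem hasAveragingGap_reflection (d : ℕ) :
    HasAveragingGap AddCircle.haarAddCircle (torusHaar d) (reflection d) :=
  (UnitAddCircle.hasAveragingGap_reflection.pi d).of_equiv (coordEquiv d)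
    (measurePreserving_coordEquiv d) (Equiv.refl _) fun _ _ _ => rfl

end FlatTorus

/-! ### Geometric graphs and doubling of the radius -/

theorem geometricGraph_mono {M : Type*} [MetricSpace M] {n : ℕ} (x : Fin n → M) {r s : ℝ}
    (h : r ≤ s) : geometricGraph x r ≤ geometricGraph x s :=
  fun _ _ hij => ⟨hij.1, hij.2.trans h⟩

theorem geometricGraph_le_comp {M : Type*} [MetricSpace M] {n : ℕ} {T : M → M}
    (hT : LipschitzWith 2 T) (x : Fin n → M) (r : ℝ) :
    geometricGraph x r ≤ geometricGraph (fun i => T (x i)) (2 * r) :=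
  fun _ _ hij => ⟨hij.1, (hT.dist_le_mul _ _).trans
    (mul_le_mul_of_nonneg_left hij.2 (NNReal.coe_nonneg 2))⟩

theorem measurableSet_geometricGraph_mem {M : Type*} [MetricSpace M] [MeasurableSpace M]
    [BorelSpace M] [SecondCountableTopology M] {n : ℕ} (F : Set (SimpleGraph (Fin n))) (r : ℝ) :
    MeasurableSet {x : Fin n → M | geometricGraph x r ∈ F} := by
  have heq : {x : Fin n → M | geometricGraph x r ∈ F} =
      ⋃ G ∈ F, ⋂ i, ⋂ j, {x | (i ≠ j ∧ dist (x i) (x j) ≤ r) ↔ G.Adj i j} := by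
    ext x
    simp only [Set.mem_ofPred_eq, Set.mem_iUnion, Set.mem_iInter, exists_prop]
    constructor
    · exact fun h => ⟨_, h, fun i j => Iff.rfl⟩
    · rintro ⟨G, hG, h⟩
      convert hG
      ext i j
      exact h i j
  rw [heq]
  refine MeasurableSet.biUnion (Set.toFinite F).countable fun G _ =>
    MeasurableSet.iInter fun i => MeasurableSet.iInter fun j => ?_
  have hd : MeasurableSet {x : Fin n → M | dist (x i) (x j) ≤ r} :=
    measurableSet_le (by fun_prop) measurable_const
  by_cases hG : G.Adj i j
  · simp only [hG, iff_true]
    exact (MeasurableSet.const (i ≠ j)).inter hd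
  · simp only [hG, iff_false]
    exact ((MeasurableSet.const (i ≠ j)).inter hd).compl

section Doubling

variable {M : Type*} [MetricSpace M] [MeasurableSpace M] {μ : Measure M} [IsProbabilityMeasure μ]
  {n : ℕ} {F : Set (SimpleGraph (Fin n))}

theorem geometricProb_ne_top (F : Set (SimpleGraph (Fin n))) (r : ℝ) :
    geometricProb μ F r ≠ ∞ := measure_ne_top _ _

theorem geometricProb_toReal_le_one (F : Set (SimpleGraph (Fin n))) (r : ℝ) :
    (geometricProb μ F r).toReal ≤ 1 :=
  ENNReal.toReal_le_of_le_ofReal zero_le_one (by simpa [geometricProb] using prob_le_one)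

theorem geometricProb_toReal_mono (hF : IsUpperSet F) :
    Monotone fun r => (geometricProb μ F r).toReal := fun _ _ hrs =>
  ENNReal.toReal_mono (geometricProb_ne_top F _)
    (measure_mono fun x hx => hF (geometricGraph_mono x hrs) hx)

/-- If the space has a family of measure-preserving `2`-Lipschitz maps `T θ`, each constant along
the maps `R θ e` of a family with averaging gap, then doubling the radius at least halves the odds
against a monotone property. -/
theorem two_mul_geometricProb_le [BorelSpace M] [SecondCountableTopology M] {Θ E : Type*}
    [MeasurableSpace Θ] {ν : Measure Θ} [IsProbabilityMeasure ν] [Fintype E] [Nonempty E]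
    {R : Θ → E → M → M} {T : Θ → M → M} (hR : HasAveragingGap ν μ R)
    (hTR : ∀ θ e x, T θ (R θ e x) = T θ x) (hT : ∀ θ, MeasurePreserving (T θ) μ μ)
    (hL : ∀ θ, LipschitzWith 2 (T θ)) (hF : IsUpperSet F) (r : ℝ) :
    2 * (geometricProb μ F r).toReal ≤
      (geometricProb μ F (2 * r)).toReal * (1 + (geometricProb μ F r).toReal) := by
  have hT' θ : MeasurePreserving (fun (x : Fin n → M) i => T θ (x i)) (Measure.pi fun _ => μ)
      (Measure.pi fun _ => μ) := measurePreserving_pi _ _ fun _ => hT θ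
  have hA s : MeasurableSet {x : Fin n → M | geometricGraph x s ∈ F} :=
    measurableSet_geometricGraph_mem F s
  refine (hR.pi n).two_mul_measureReal_le (hA r) (fun θ => (hT' θ).measurable (hA (2 * r)))
    (fun θ e x he => ?_) fun θ => ?_
  -- Folding the reflected configuration at most doubles distances, so it keeps the property at `2 *
  -- r`; the fold forgets the reflections, even when chosen separately for each vertex.
  · have hmem := hF (geometricGraph_le_comp (hL θ) _ r) he
    simp only [hTR] at hmem
    exact hmem
  · rw [measureReal_def, (hT' θ).measure_preimage (hA (2 * r)).nullMeasurableSet]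
    rfl

end Doubling

/-! ### From odds to thresholds -/

section Threshold

/-- The odds `g / (1 - g)` gain a factor `2` at each doubling, since `2b ≤ c(1 + b)` rearranges to
`2b(1 - c) ≤ c(1 - b)`. Clearing denominators allows the value `1`. -/
theorem odds_iterate {g : ℝ → ℝ} (h0 : ∀ r, 0 ≤ g r) (h1 : ∀ r, g r ≤ 1)
    (hdouble : ∀ r, 2 * g r ≤ g (2 * r) * (1 + g r)) (r : ℝ) (m : ℕ) :
    2 ^ m * g r * (1 - g (2 ^ m * r)) ≤ g (2 ^ m * r) * (1 - g r) := by
  induction m with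
  | zero => simp [mul_sub, mul_comm]
  | succ m ih =>
    have hd := hdouble (2 ^ m * r)
    rw [← mul_assoc, ← pow_succ'] at hd
    set a := g r
    set b := g (2 ^ m * r)
    set c := g (2 ^ (m + 1) * r)
    have ha0 : 0 ≤ a := h0 _
    have ha1 : a ≤ 1 := h1 _
    have hb0 : 0 ≤ b := h0 _
    have hc0 : 0 ≤ c := h0 _
    have hp : (0 : ℝ) < 2 ^ m := by positivity
    rcases hb0.eq_or_lt with hb | hb
    · rw [← hb] at ih
      have : a = 0 := by nlinarith
      rw [this]
      simpa using hc0
    · refine le_of_mul_le_mul_right ?_ hb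
      calc 2 ^ (m + 1) * a * (1 - c) * b = 2 ^ m * a * (2 * b * (1 - c)) := by ring
        _ ≤ 2 ^ m * a * (c * (1 - b)) := by
            refine mul_le_mul_of_nonneg_left ?_ (by positivity)
            linarith
        _ = c * (2 ^ m * a * (1 - b)) := by ring
        _ ≤ c * (b * (1 - a)) := mul_le_mul_of_nonneg_left ih hc0
        _ = c * (1 - a) * b := by ring

/-- A monotone function satisfying the odds-halving inequality has a positive median. -/
theorem exists_median {g : ℝ → ℝ} (hmono : Monotone g) (h0 : ∀ r, 0 ≤ g r) (h1 : ∀ r, g r ≤ 1)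
    (hdouble : ∀ r, 2 * g r ≤ g (2 * r) * (1 + g r)) (hlarge : ∃ r, 1 / 2 < g r)
    (hsmall : ∃ r, 0 < r ∧ g r < 1) :
    ∃ ρ, 0 < ρ ∧ (∀ s < ρ, g s ≤ 1 / 2) ∧ ∀ s > ρ, 1 / 2 < g s := by
  obtain ⟨L, hL⟩ := hlarge
  obtain ⟨η, hη, hη1⟩ := hsmall
  have hbdd : BddAbove {s | g s ≤ 1 / 2} := by
    refine ⟨L, fun s hs => ?_⟩
    by_contra! hlt
    exact absurd (hmono hlt.le) (not_le.2 (lt_of_le_of_lt hs hL))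
  obtain ⟨m, hm⟩ := pow_unbounded_of_one_lt (1 / (1 - g η)) (one_lt_two (α := ℝ))
  have hp : (0 : ℝ) < 2 ^ m := by positivity
  -- If `g` exceeded `1/2` here, `m` doublings would force `2 ^ m * (1 - g η) < 1`, against the
  -- choice of `m`.
  have hmem : η / 2 ^ m ∈ {s | g s ≤ 1 / 2} := by
    by_contra! hlt
    have hlt' : 1 / 2 < g (η / 2 ^ m) := not_le.1 hlt
    have ho := odds_iterate h0 h1 hdouble (η / 2 ^ m) m
    rw [mul_div_cancel₀ _ hp.ne'] at ho
    rw [div_lt_iff₀ (by linarith)] at hm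
    nlinarith [h0 η, mul_pos hp (sub_pos.2 hη1)]
  refine ⟨sSup {s | g s ≤ 1 / 2}, (div_pos hη hp).trans_le (le_csSup hbdd hmem),
    fun s hs => ?_, fun s hs => ?_⟩
  · obtain ⟨u, hu, hsu⟩ := exists_lt_of_lt_csSup ⟨_, hmem⟩ hs
    exact (hmono hsu.le).trans hu
  · by_contra! hle
    exact absurd (le_csSup hbdd hle) (not_le.2 hs)

variable {M : Type*} [MetricSpace M] [MeasurableSpace M] {μ : Measure M} [IsProbabilityMeasure μ]

/-- Spaces in which doubling the radius at least halves the odds against every monotone property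
admit thresholds, provided that nontrivial properties have probability more than `1 / 2` at some
radius and less than `1` at some positive radius. -/
theorem admitsThresholds_of_two_mul_le
    (hdouble : ∀ (n : ℕ) (F : Set (SimpleGraph (Fin n))), IsUpperSet F → ∀ r,
      2 * (geometricProb μ F r).toReal ≤
        (geometricProb μ F (2 * r)).toReal * (1 + (geometricProb μ F r).toReal))
    (hlarge : ∀ (n : ℕ) (F : Set (SimpleGraph (Fin n))), IsNontrivialMonotone F →
      ∃ r, 1 / 2 < (geometricProb μ F r).toReal)
    (hsmall : ∀ (n : ℕ) (F : Set (SimpleGraph (Fin n))), IsNontrivialMonotone F →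
      ∃ r, 0 < r ∧ (geometricProb μ F r).toReal < 1) :
    AdmitsThresholds M μ := by
  intro F hF
  have hmed : ∀ n, ∃ ρ, 0 < ρ ∧ (2 ≤ n → (∀ s < ρ, (geometricProb μ (F n) s).toReal ≤ 1 / 2) ∧
      ∀ s > ρ, 1 / 2 < (geometricProb μ (F n) s).toReal) := by
    intro n
    by_cases hn : 2 ≤ n
    · obtain ⟨ρ, hρ, h⟩ := exists_median (geometricProb_toReal_mono (μ := μ) (hF n hn).monotone)
        (fun r => ENNReal.toReal_nonneg) (geometricProb_toReal_le_one (F n))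
        (hdouble n (F n) (hF n hn).monotone) (hlarge n _ (hF n hn)) (hsmall n _ (hF n hn))
      exact ⟨ρ, hρ, fun _ => h⟩
    -- For `n < 2` any positive radius serves.
    · exact ⟨1, one_pos, fun h => absurd h hn⟩
  choose r hr hmed using hmed
  have hodds n (hn : 2 ≤ n) := odds_iterate (g := fun s => (geometricProb μ (F n) s).toReal)
    (fun s => ENNReal.toReal_nonneg) (geometricProb_toReal_le_one (F n))
    (hdouble n (F n) (hF n hn).monotone)
  have hpow {ε : ℝ} (hε : 0 < ε) : ∃ m : ℕ, 1 < ε * 2 ^ m := by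
    obtain ⟨m, hm⟩ := pow_unbounded_of_one_lt (1 / ε) (one_lt_two (α := ℝ))
    exact ⟨m, by rwa [div_lt_iff₀' hε] at hm⟩
  refine ⟨r, hr, fun s _ hsr => ?_, fun s _ hsr => ?_⟩
  · rw [← ENNReal.tendsto_toReal_iff (fun n => geometricProb_ne_top (F n) _) ENNReal.zero_ne_top,
      Metric.tendsto_atTop']
    intro ε hε
    obtain ⟨m, hm⟩ := hpow hε
    have hp : (0 : ℝ) < 2 ^ m := by positivity
    obtain ⟨N, hN⟩ := eventually_atTop.1
      ((hsr.eventually_lt_const (inv_pos.2 hp)).and (eventually_ge_atTop 2))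
    refine ⟨N, fun n hn => ?_⟩
    obtain ⟨hlt, hn2⟩ := hN n hn.le
    rw [div_lt_iff₀ (hr n), inv_mul_eq_div, lt_div_iff₀' hp] at hlt
    have hb := (hmed n hn2).1 _ hlt
    have ho := hodds n hn2 (s n) m
    rw [ENNReal.toReal_zero, Real.dist_eq, sub_zero, abs_of_nonneg ENNReal.toReal_nonneg]
    set a := (geometricProb μ (F n) (s n)).toReal
    set b := (geometricProb μ (F n) (2 ^ m * s n)).toReal
    have ha0 : 0 ≤ a := ENNReal.toReal_nonneg
    have hb0 : 0 ≤ b := ENNReal.toReal_nonneg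
    -- Odds at most `1` at `2 ^ m * s n` mean odds at most `2⁻ᵐ` at `s n`.
    have hpa : 2 ^ m * a ≤ 1 := by nlinarith [mul_nonneg hp.le ha0, mul_nonneg hb0 ha0]
    by_contra! hge
    nlinarith [mul_le_mul_of_nonneg_left hge hp.le]
  · rw [← ENNReal.tendsto_toReal_iff (fun n => geometricProb_ne_top (F n) _) ENNReal.one_ne_top,
      Metric.tendsto_atTop']
    intro ε hε
    obtain ⟨m, hm⟩ := hpow hε
    have hp : (0 : ℝ) < 2 ^ m := by positivity
    obtain ⟨N, hN⟩ := eventually_atTop.1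
      ((hsr.eventually_gt_atTop (2 ^ m)).and (eventually_ge_atTop 2))
    refine ⟨N, fun n hn => ?_⟩
    obtain ⟨hlt, hn2⟩ := hN n hn.le
    rw [lt_div_iff₀ (hr n), ← lt_div_iff₀' hp] at hlt
    have ha := (hmed n hn2).2 _ hlt
    have ho := hodds n hn2 (s n / 2 ^ m) m
    simp only [mul_div_cancel₀ _ hp.ne'] at ho
    have hb1 := geometricProb_toReal_le_one (μ := μ) (F n) (s n)
    rw [ENNReal.toReal_one, Real.dist_eq, abs_sub_comm, abs_of_nonneg (sub_nonneg.2 hb1)]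
    set a := (geometricProb μ (F n) (s n / 2 ^ m)).toReal
    set b := (geometricProb μ (F n) (s n)).toReal
    have hb0 : 0 ≤ b := ENNReal.toReal_nonneg
    -- Dually, odds above `1` at `s n / 2 ^ m` leave failure probability at most `2⁻ᵐ` at `s n`.
    have hpb : 2 ^ m * (1 - b) ≤ 1 := by
      nlinarith [mul_nonneg hp.le (sub_nonneg.2 hb1)]
    by_contra! hge
    nlinarith [mul_le_mul_of_nonneg_left hge hp.le]

/-- At the diameter the graph is complete, and a nonempty upper set contains the complete graph. -/
theorem exists_half_lt_geometricProb [BoundedSpace M] {n : ℕ} {F : Set (SimpleGraph (Fin n))}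
    (hF : IsNontrivialMonotone F) : ∃ r, 1 / 2 < (geometricProb μ F r).toReal := by
  refine ⟨Metric.diam (Set.univ : Set M), ?_⟩
  obtain ⟨G, hG⟩ := Set.nonempty_iff_ne_empty.2 hF.ne_empty
  have huniv : {x : Fin n → M | geometricGraph x (Metric.diam (Set.univ : Set M)) ∈ F} =
      Set.univ := by
    refine Set.eq_univ_of_forall fun x => hF.monotone (fun i j hij => ?_) hG
    exact ⟨hij.ne, Metric.dist_le_diam_of_mem (Bornology.IsBounded.all _)
      (Set.mem_univ _) (Set.mem_univ _)⟩
  rw [geometricProb, huniv, measure_univ]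
  norm_num

/-- Configurations near `n` distinct points form an open set of positive measure on which the graph
is edgeless at a small radius; the edgeless graph is not in a nontrivial upper set. -/
theorem exists_geometricProb_lt_one [BorelSpace M] [SecondCountableTopology M] [Infinite M]
    [μ.IsOpenPosMeasure] {n : ℕ} {F : Set (SimpleGraph (Fin n))} (hF : IsNontrivialMonotone F) :
    ∃ r, 0 < r ∧ (geometricProb μ F r).toReal < 1 := by
  have hbot : ⊥ ∉ F := fun h =>
    hF.ne_univ (Set.eq_univ_of_forall fun G => hF.monotone bot_le h)
  let y : Fin n → M := fun i => Infinite.natEmbedding M i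
  have hy : Function.Injective y :=
    (Infinite.natEmbedding M).injective.comp Fin.val_injective
  obtain ⟨η, hη, hsep⟩ : ∃ η : ℝ, 0 < η ∧ ∀ i j, i ≠ j → η < dist (y i) (y j) := by
    have hev : ∀ᶠ η : ℝ in 𝓝[>] 0, ∀ i j, i ≠ j → η < dist (y i) (y j) := by
      simp only [eventually_all]
      exact fun i j hij => nhdsWithin_le_nhds (eventually_lt_nhds (dist_pos.2 (hy.ne hij)))
    exact (hev.and self_mem_nhdsWithin).exists.imp fun η h => ⟨h.2, h.1⟩
  refine ⟨η, hη, ?_⟩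
  let U : Set (Fin n → M) := ⋂ i, ⋂ j, {x | i ≠ j → η < dist (x i) (x j)}
  have hU : IsOpen U := by
    refine isOpen_iInter_of_finite fun i => isOpen_iInter_of_finite fun j => ?_
    by_cases hij : i = j
    · simp [hij]
    · simp only [ne_eq, hij, not_false_eq_true, forall_const]
      exact isOpen_lt continuous_const (by fun_prop)
  have hyU : y ∈ U := Set.mem_iInter.2 fun i => Set.mem_iInter.2 fun j => hsep i j
  have hsub : {x : Fin n → M | geometricGraph x η ∈ F} ⊆ Uᶜ := by
    intro x hx hxU
    refine hbot ?_
    convert (show geometricGraph x η ∈ F from hx)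
    refine (eq_bot_iff.2 fun i j hij => ?_).symm
    exact absurd hij.2 (not_le.2 (Set.mem_iInter.1 (Set.mem_iInter.1 hxU i) j hij.1))
  have hpos : 0 < Measure.pi (fun _ : Fin n => μ) U := hU.measure_pos _ ⟨y, hyU⟩
  have hlt : Measure.pi (fun _ : Fin n => μ) Uᶜ < 1 := by
    rw [prob_compl_eq_one_sub hU.measurableSet]
    exact ENNReal.sub_lt_self ENNReal.one_ne_top one_ne_zero hpos.ne'
  have hfin := (measure_mono hsub).trans_lt hlt
  simpa using (ENNReal.toReal_lt_toReal (geometricProb_ne_top F η) ENNReal.one_ne_top).2 hfin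

end Threshold

/-! ### Conclusion for the torus -/

theorem FlatTorus.infinite {d : ℕ} (hd : 1 ≤ d) : Infinite (FlatTorus d) := by
  have : Nonempty (Fin d) := ⟨⟨0, hd⟩⟩
  have : Infinite UnitAddCircle := by
    have : Infinite (Set.Ico (0 : ℝ) (0 + 1)) := (Set.Ico_infinite (by norm_num)).to_subtype
    exact Infinite.of_injective _ (AddCircle.equivIco (1 : ℝ) 0).symm.injective
  exact Infinite.of_injective _ (WithLp.toLp_injective 2 (V := Fin d → UnitAddCircle))

theorem theorem2 (d : ℕ) (hd : 1 ≤ d) : AdmitsThresholds (FlatTorus d) (torusHaar d) := by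
  have := FlatTorus.infinite hd
  have : (torusHaar d).IsAddHaarMeasure := by unfold torusHaar; infer_instance
  refine admitsThresholds_of_two_mul_le (fun n F hF r => ?_)
    (fun n F hF => exists_half_lt_geometricProb hF)
    (fun n F hF => exists_geometricProb_lt_one hF)
  exact two_mul_geometricProb_le (FlatTorus.hasAveragingGap_reflection d)
    (FlatTorus.fold_reflection d) (FlatTorus.measurePreserving_fold d)
    (FlatTorus.lipschitzWith_fold d) hF r
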